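/- Let $\mathbf{Gpd}$ be the category of small groupoids and functors, and let $\mathbf{Gpd}^{\mathbb{Z}_2} = [\mathbf{B}(\mathbb{Z}_2),\mathbf{Gpd}]$ be the category of functors from the one-object groupoid $\mathbf{B}(\mathbb{Z}_2)$ of the group with two elements to $\mathbf{Gpd}$; its objects are groupoids equipped with an involution and its morphisms are equivariant functors. Call a functor of groupoids $F\colon A\to B$ an isofibration if for every object $a$ of $A$ and every morphism $\varphi\colon F(a)\to b$ in $B$ there is a morphism $\psi\colon a\to a'$ in $A$ with $F(a')=b$ and $F(\psi)=\varphi$. Call a morphism of $\mathbf{Gpd}^{\mathbb{Z}_2}$ a projective fibration if its underlying functor of groupoids is an isofibration. Then $\mathbf{Gpd}^{\mathbb{Z}_2}$ is a type-theoretic fibration category in which the fibrations are the projective fibrations. That is: 1. $\mathbf{Gpd}^{\mathbb{Z}_2}$ has a terminal object $\mathbf{1}$. 2. The projective fibrations form a subcategory which contains all isomorphisms and all morphisms with codomain $\mathbf{1}$. 3. All pullbacks of projective fibrations (along arbitrary morphisms) exist and are projective fibrations. 4. For every projective fibration $g\colon A\to B$, the pullback functor $g^*\colon \mathbf{Gpd}^{\mathbb{Z}_2}/B\to\mathbf{Gpd}^{\mathbb{Z}_2}/A$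 has a partial right adjoint $\Pi_g$, defined at all projective fibrations over $A$, whose values there are projective fibrations over $B$. 5. Every morphism factors as an acyclic cofibration followed by a projective fibration, where an acyclic cofibration is a morphism with the left lifting property with respect to all projective fibrations. -/

import Mathlib

universe v u

open CategoryTheory Limits

namespace ProjectiveTTFC

/-- A functor is an isofibration if every isomorphism out of an object `F.obj a` lifts to an
isomorphism out of `a`. The source and target are groupoids here, so all morphisms are
isomorphisms; the equality of morphisms is taken after transport along `F.obj a' = b`. -/
def IsIsofibration {A B : Type*} [Groupoid A] [Groupoid B] (F : A ⥤ B) : Prop :=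
  ∀ (a : A) (b : B) (φ : F.obj a ⟶ b),
    ∃ (a' : A) (ψ : a ⟶ a') (h : F.obj a' = b), F.map ψ ≫ eqToHom h = φ

/-- The fibrations of the natural model structure on the category of small groupoids. -/
def isofibrations : MorphismProperty Grpd.{u, u} :=
  fun A B F => IsIsofibration (A := A) (B := B) F

/-- The category of groupoids with an involution and equivariant functors, as the functor category
from the one-object groupoid of the group with two elements to the category of small groupoids. -/
abbrev GpdZ2 : Type (u + 1) :=
  SingleObj (Multiplicative (ZMod 2)) ⥤ Grpd.{u, u}

/-- The projective fibrations: the objectwise isofibrations. -/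
def projectiveFibrations : MorphismProperty GpdZ2.{u} :=
  isofibrations.{u}.functorCategory (SingleObj (Multiplicative (ZMod 2)))

/-- The acyclic cofibrations with respect to a class `fib` of fibrations: the morphisms with
the left lifting property with respect to all fibrations. -/
abbrev acyclicCofibrations {C : Type u} [Category.{v} C] (fib : MorphismProperty C) :
    MorphismProperty C :=
  fib.llp

/-- The category `C` is a type-theoretic fibration category with class of fibrations `fib`. -/
structure IsTypeTheoreticFibrationCategory {C : Type u} [Category.{v} C]
    (fib : MorphismProperty C) : Prop where
  /-- There is a terminal object. -/
  hasTerminal : HasTerminal C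
  /-- Fibrations form a subcategory. -/
  isMultiplicative : fib.IsMultiplicative
  /-- Isomorphisms are fibrations. -/
  of_isIso : ∀ {X Y : C} (f : X ⟶ Y), IsIso f → fib f
  /-- Morphisms with terminal codomain are fibrations. -/
  of_isTerminal : ∀ {X T : C} (f : X ⟶ T), IsTerminal T → fib f
  /-- The pullback of a fibration along any morphism exists. -/
  hasPullbacksAlong : ∀ {A B : C} (g : A ⟶ B), fib g → HasPullbacksAlong g
  /-- Any pullback of a fibration is a fibration. -/
  isStableUnderBaseChange : fib.IsStableUnderBaseChange
  /-- For a fibration `g : A ⟶ B`, the partial right adjoint `Π_g` of the pullback functor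
  `Over B ⥤ Over A` is defined at all fibrations over `A`. -/
  pi_isDefined : ∀ {A B : C} (g : A ⟶ B) (hg : fib g) (f : Over A), fib f.hom →
    haveI : HasPullbacksAlong g := fun h => hasPullbacksAlong g hg h
    (Over.pullback g).rightAdjointObjIsDefined f
  /-- The value of `Π_g` at a fibration over `A` is a fibration over `B`. -/
  pi_fib : ∀ {A B : C} (g : A ⟶ B) (hg : fib g),
    haveI : HasPullbacksAlong g := fun h => hasPullbacksAlong g hg h
    ∀ f : (Over.pullback g).PartialRightAdjointSource, fib f.obj.hom →
      fib ((Over.pullback g).partialRightAdjoint.obj f).hom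
  /-- Every morphism is an acyclic cofibration followed by a fibration. -/
  hasFactorization : MorphismProperty.HasFactorization (acyclicCofibrations fib) fib

end ProjectiveTTFC

/-! A functor of groupoids is an isofibration iff it has the right lifting property against the
inclusion of an endpoint into the walking isomorphism (`isofibrations_eq_rlp`). This gives closure
under composition and base change, objectwise and hence for projective fibrations.

For dependent products, the groupoid of sections over the strict fibers of an isofibration `g`
(`PiObj`, `PiHom`) has the universal property of `Π_g`, and its projection to the base is an
isofibration when `f` is one too (`isIsofibration_piProj`). Since the indexing category is a
groupoid, naturality squares are pullbacks. The universal property, stated for all pullback squares,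
therefore transports the involution to the objectwise dependent products (`PiDatum.exists_functor`).

For factorizations, one pushout suffices instead of a transfinite construction: attach a free
interval for every lifting problem of `f` against the endpoint inclusion. The resulting `i : X ⟶ P`
has the left lifting property, so every object of `P` is connected to its image
(`connectedToImage_of_llp`). Lifting paths that start in `X` then suffices to lift all paths
(`isIsofibration_of_essSurj`). -/

namespace ProjectiveTTFC

/-! ### Lifts of morphisms along functors of groupoids -/

section Lifts

variable {A B : Type*} [Groupoid A] [Groupoid B]

/-- `IsHomLift` absorbs the transport along equalities of objects, so that later arguments avoid
`eqToHom`. -/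
theorem IsIsofibration.exists_isHomLift {F : A ⥤ B} (hF : IsIsofibration F) {b b' : B}
    (β : b ⟶ b') {a : A} (ha : F.obj a = b) :
    ∃ (a' : A) (ψ : a ⟶ a'), F.IsHomLift β ψ := by
  subst ha
  obtain ⟨a', ψ, h, rfl⟩ := hF a b' β
  exact ⟨a', ψ, inferInstance⟩

theorem isIsofibration_of_exists_isHomLift {F : A ⥤ B}
    (hF : ∀ (a : A) (b : B) (φ : F.obj a ⟶ b), ∃ (a' : A) (ψ : a ⟶ a'), F.IsHomLift φ ψ) :
    IsIsofibration F := by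
  intro a b φ
  obtain ⟨a', ψ, h⟩ := hF a b φ
  exact ⟨a', ψ, IsHomLift.codomain_eq F φ ψ, by simp [IsHomLift.fac' F φ ψ]⟩

theorem isHomLift_inv_comp {F : A ⥤ B} {b b' b'' : B} {β : b ⟶ b'} {β' : b' ⟶ b''} {a a' a'' : A}
    {α : a ⟶ a'} {γ : a ⟶ a''} (hα : F.IsHomLift β α) (hγ : F.IsHomLift (β ≫ β') γ) :
    F.IsHomLift β' (inv α ≫ γ) := by
  have : F.IsHomLift (inv β ≫ β ≫ β') (inv α ≫ γ) := inferInstance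
  simpa using this

theorem isHomLift_inv_of {F : A ⥤ B} {b b' : B} {β : b ⟶ b'} {a a' : A} {α : a' ⟶ a}
    (hα : F.IsHomLift (inv β) α) : F.IsHomLift β (inv α) := by
  simpa using (inferInstance : F.IsHomLift (inv (inv β)) (inv α))

theorem isHomLift_of_eq {C D : Type*} [Category* C] [Category* D] {F : C ⥤ D} {b b' : D}
    {β β' : b ⟶ b'} {a a' : C} {α α' : a ⟶ a'}
    (h : F.IsHomLift β α) (hβ : β = β') (hα : α = α') : F.IsHomLift β' α' := by
  subst hβ hα; exact h

/-- A triangle of functors commutes iff the images of each morphism lie over each other. -/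
theorem comp_eq_iff_isHomLift {C D E : Type*} [Category* C] [Category* D] [Category* E]
    {P : E ⥤ C} {F : C ⥤ D} {Q : E ⥤ D} :
    P ⋙ F = Q ↔ ∀ ⦃x y : E⦄ (φ : x ⟶ y), F.IsHomLift (Q.map φ) (P.map φ) := by
  constructor
  · rintro rfl x y φ
    exact Functor.IsHomLift.map _
  · intro h
    refine CategoryTheory.Functor.ext (fun x => ?_) fun x y φ => ?_
    · have := h (𝟙 x)
      exact IsHomLift.domain_eq F (Q.map (𝟙 x)) (P.map (𝟙 x))
    · have := h φ
      exact IsHomLift.fac' F (Q.map φ) (P.map φ)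

end Lifts

/-! ### Strict pullbacks of groupoids -/

section Pullback

variable {T A B : Type u} [Groupoid.{u} T] [Groupoid.{u} A] [Groupoid.{u} B]

/-- The strict pullback of groupoids. -/
structure Pb (k : T ⥤ B) (g : A ⥤ B) : Type u where
  fst : T
  snd : A
  w : g.obj snd = k.obj fst

variable {k : T ⥤ B} {g : A ⥤ B}

/-- Morphisms in the strict pullback of groupoids. -/
@[ext]
structure Pb.Hom (x y : Pb k g) : Type u where
  fst : x.fst ⟶ y.fst
  snd : x.snd ⟶ y.snd
  w : g.IsHomLift (k.map fst) snd

noncomputable instance : Groupoid (Pb k g) where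
  Hom := Pb.Hom
  id x := ⟨𝟙 _, 𝟙 _, isHomLift_of_eq (IsHomLift.id x.w) (by simp) rfl⟩
  comp φ ψ := ⟨φ.fst ≫ ψ.fst, φ.snd ≫ ψ.snd, by
    have := φ.w; have := ψ.w; rw [k.map_comp]; infer_instance⟩
  id_comp φ := by ext <;> simp
  comp_id φ := by ext <;> simp
  assoc φ ψ χ := by ext <;> simp
  inv φ := ⟨inv φ.fst, inv φ.snd, by have := φ.w; rw [k.map_inv]; infer_instance⟩
  inv_comp φ := by ext <;> simp
  comp_inv φ := by ext <;> simp

namespace Pb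

variable (k g) in
/-- The first projection. -/
@[simps] noncomputable def fstFunctor : Pb k g ⥤ T where
  obj x := x.fst
  map φ := φ.fst
  map_id _ := rfl
  map_comp _ _ := rfl

variable (k g) in
/-- The second projection. -/
@[simps] noncomputable def sndFunctor : Pb k g ⥤ A where
  obj x := x.snd
  map φ := φ.snd
  map_id _ := rfl
  map_comp _ _ := rfl

theorem condition : sndFunctor k g ⋙ g = fstFunctor k g ⋙ k :=
  comp_eq_iff_isHomLift.2 fun _ _ φ => φ.w

/-- The functor into the strict pullback induced by a commutative square. -/
@[simps] noncomputable def lift {U : Type*} [Category* U] (F : U ⥤ T) (G : U ⥤ A)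
    (h : G ⋙ g = F ⋙ k) : U ⥤ Pb k g where
  obj x := ⟨F.obj x, G.obj x, Functor.congr_obj h x⟩
  map φ := ⟨F.map φ, G.map φ, comp_eq_iff_isHomLift.1 h φ⟩
  map_id x := by apply Pb.Hom.ext <;> simp <;> rfl
  map_comp φ ψ := by apply Pb.Hom.ext <;> simp <;> rfl

theorem functor_ext {U : Type*} [Category* U] {F G : U ⥤ Pb k g}
    (h₁ : F ⋙ fstFunctor k g = G ⋙ fstFunctor k g)
    (h₂ : F ⋙ sndFunctor k g = G ⋙ sndFunctor k g) : F = G := by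
  -- By structure eta, a functor into the strict pullback is definitionally the lift of its two
  -- components.
  have key : ∀ H : U ⥤ Pb k g, H = lift (H ⋙ fstFunctor k g) (H ⋙ sndFunctor k g)
    (by rw [Functor.assoc, condition]; rfl) := fun _ => rfl
  rw [key F, key G]
  congr 1

end Pb

theorem isPullback_pb {T A B : Grpd.{u, u}} (k : T ⟶ B) (g : A ⟶ B) :
    IsPullback (C := Grpd.{u, u}) (P := Grpd.of (Pb k g))
      (Pb.fstFunctor k g) (Pb.sndFunctor k g) k g :=
  IsPullback.mk ⟨(Pb.condition (k := k) (g := g)).symm⟩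
    ⟨PullbackCone.IsLimit.mk _
      (fun s => Pb.lift (k := k) (g := g) s.fst s.snd s.condition.symm)
      (fun _ => rfl) (fun _ => rfl)
      (fun _ _ h₁ h₂ => Pb.functor_ext h₁ h₂)⟩

instance : HasPullbacks Grpd.{u, u} :=
  have : ∀ {X Y Z : Grpd.{u, u}} {f : X ⟶ Z} {g : Y ⟶ Z}, HasLimit (cospan f g) :=
    fun {_ _ _ f g} => (isPullback_pb f g).hasPullback
  hasPullbacks_of_hasLimit_cospan _

end Pullback

/-! ### The groupoid of fiberwise sections -/

section DependentProduct

variable {A B X : Type u} [Groupoid.{u} A] [Groupoid.{u} B] [Groupoid.{u} X]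

/-- The objects of the dependent product of `f : X ⥤ A` along the isofibration `g : A ⥤ B`:
an object of `B` together with a section of `f` over the strict fiber of `g`. -/
structure PiObj (g : A ⥤ B) (f : X ⥤ A) (hg : IsIsofibration g) : Type u where
  base : B
  obj (a : A) (h : g.obj a = base) : X
  map {a a' : A} (h : g.obj a = base) (h' : g.obj a' = base) (α : a ⟶ a')
    (hα : g.IsHomLift (𝟙 base) α) : obj a h ⟶ obj a' h'
  isHomLift_map {a a' : A} (h : g.obj a = base) (h' : g.obj a' = base) (α : a ⟶ a')
    (hα : g.IsHomLift (𝟙 base) α) : f.IsHomLift α (map h h' α hα)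
  map_comp {a a' a'' : A} (h : g.obj a = base) (h' : g.obj a' = base) (h'' : g.obj a'' = base)
    (α : a ⟶ a') (α' : a' ⟶ a'') (hα : g.IsHomLift (𝟙 base) α) (hα' : g.IsHomLift (𝟙 base) α') :
    map h h'' (α ≫ α') inferInstance = map h h' α hα ≫ map h' h'' α' hα'

variable {g : A ⥤ B} {f : X ⥤ A} {hg : IsIsofibration g}

/-- The morphisms of the dependent product: a morphism `base` of `B` together with a compatible
choice of a morphism of `X` over each morphism of `A` over `base`. -/
structure PiHom (s t : PiObj g f hg) : Type u where
  base : s.base ⟶ t.base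
  app {a a' : A} (h : g.obj a = s.base) (h' : g.obj a' = t.base) (α : a ⟶ a')
    (hα : g.IsHomLift base α) : s.obj a h ⟶ t.obj a' h'
  isHomLift_app {a a' : A} (h : g.obj a = s.base) (h' : g.obj a' = t.base) (α : a ⟶ a')
    (hα : g.IsHomLift base α) : f.IsHomLift α (app h h' α hα)
  map_app {a a' a'' : A} (h : g.obj a = s.base) (h' : g.obj a' = s.base) (h'' : g.obj a'' = t.base)
    (γ : a ⟶ a') (α : a' ⟶ a'') (hγ : g.IsHomLift (𝟙 s.base) γ) (hα : g.IsHomLift base α) :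
    app h h'' (γ ≫ α) inferInstance = s.map h h' γ hγ ≫ app h' h'' α hα
  app_map {a a' a'' : A} (h : g.obj a = s.base) (h' : g.obj a' = t.base) (h'' : g.obj a'' = t.base)
    (α : a ⟶ a') (γ : a' ⟶ a'') (hα : g.IsHomLift base α) (hγ : g.IsHomLift (𝟙 t.base) γ) :
    app h h'' (α ≫ γ) inferInstance = app h h' α hα ≫ t.map h' h'' γ hγ

theorem PiHom.ext {s t : PiObj g f hg} {u v : PiHom s t} (hb : u.base = v.base)
    (happ : ∀ (a a' : A) (h : g.obj a = s.base) (h' : g.obj a' = t.base) (α : a ⟶ a')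
      (hα : g.IsHomLift u.base α) (hα' : g.IsHomLift v.base α),
      u.app h h' α hα = v.app h h' α hα') : u = v := by
  obtain ⟨ub, ua, _, _, _⟩ := u
  obtain ⟨vb, va, _, _, _⟩ := v
  obtain rfl : ub = vb := hb
  obtain rfl : @ua = @va := by
    funext a a' h h' α hα
    exact happ a a' h h' α hα hα
  rfl

theorem PiHom.app_congr {s t : PiObj g f hg} (u : PiHom s t) {a a' : A} (h : g.obj a = s.base)
    (h' : g.obj a' = t.base) {α α' : a ⟶ a'} (hα : g.IsHomLift u.base α) (e : α = α') :
    u.app h h' α hα = u.app h h' α' (e ▸ hα) := by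
  subst e; rfl

theorem PiObj.map_congr (s : PiObj g f hg) {a a' : A} (h : g.obj a = s.base)
    (h' : g.obj a' = s.base) {α α' : a ⟶ a'} (hα : g.IsHomLift (𝟙 s.base) α) (e : α = α') :
    s.map h h' α hα = s.map h h' α' (e ▸ hα) := by
  subst e; rfl

/-- Preservation of identities need not be a field: `map_comp` makes the image of an identity
idempotent, and an idempotent in a groupoid is an identity. -/
theorem PiObj.map_id (s : PiObj g f hg) {a : A} (h : g.obj a = s.base)
    (hα : g.IsHomLift (𝟙 s.base) (𝟙 a)) : s.map h h (𝟙 a) hα = 𝟙 _ := by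
  have := s.map_comp h h h (𝟙 a) (𝟙 a) hα hα
  rw [s.map_congr h h _ (Category.comp_id _)] at this
  exact (cancel_epi (s.map h h (𝟙 a) hα)).1 (this.symm.trans (Category.comp_id _).symm)

theorem PiObj.map_inv (s : PiObj g f hg) {a a' : A} (h : g.obj a = s.base)
    (h' : g.obj a' = s.base) (α : a ⟶ a') (hα : g.IsHomLift (𝟙 s.base) α) :
    s.map h' h (inv α) inferInstance = inv (s.map h h' α hα) := by
  apply IsIso.eq_inv_of_hom_inv_id
  rw [← s.map_comp, s.map_congr h h _ (IsIso.hom_inv_id α), s.map_id]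

/-- The identity morphism of the dependent product. -/
def PiHom.id (s : PiObj g f hg) : PiHom s s where
  base := 𝟙 _
  app h h' α hα := s.map h h' α hα
  isHomLift_app h h' α hα := s.isHomLift_map h h' α hα
  map_app h h' h'' γ α hγ hα := s.map_comp h h' h'' γ α hγ hα
  app_map h h' h'' γ α hγ hα := s.map_comp h h' h'' γ α hγ hα

include hg in
-- Composites in the dependent product are computed along such factorizations; here the isofibration
-- hypothesis makes composition possible.
theorem exists_factorization {b b' b'' : B} (β : b ⟶ b') (β' : b' ⟶ b'') {a a'' : A}
    (h : g.obj a = b) (α : a ⟶ a'') (hα : g.IsHomLift (β ≫ β') α) :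
    ∃ (a' : A) (_ : g.obj a' = b') (α₁ : a ⟶ a') (α₂ : a' ⟶ a''),
      g.IsHomLift β α₁ ∧ g.IsHomLift β' α₂ ∧ α₁ ≫ α₂ = α := by
  obtain ⟨a', α₁, h₁⟩ := hg.exists_isHomLift β h
  exact ⟨a', IsHomLift.codomain_eq g β α₁, α₁, inv α₁ ≫ α, h₁, isHomLift_inv_comp h₁ hα, by simp⟩

/-- Two factorizations over the same pair of base morphisms differ by `inv α₁ ≫ β₁`, which lies over
an identity and can be moved across the composite by `app_map` and `map_app`. Hence composition does
not depend on the chosen factorization. -/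
theorem PiHom.app_comp_app_eq {s t r : PiObj g f hg} (u : PiHom s t) (v : PiHom t r)
    {a a' b' a'' : A} (h : g.obj a = s.base) (h' : g.obj a' = t.base) (k' : g.obj b' = t.base)
    (h'' : g.obj a'' = r.base) {α₁ : a ⟶ a'} {α₂ : a' ⟶ a''} {β₁ : a ⟶ b'} {β₂ : b' ⟶ a''}
    (hα₁ : g.IsHomLift u.base α₁) (hα₂ : g.IsHomLift v.base α₂)
    (hβ₁ : g.IsHomLift u.base β₁) (hβ₂ : g.IsHomLift v.base β₂) (e : α₁ ≫ α₂ = β₁ ≫ β₂) :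
    u.app h h' α₁ hα₁ ≫ v.app h' h'' α₂ hα₂ = u.app h k' β₁ hβ₁ ≫ v.app k' h'' β₂ hβ₂ := by
  have hγ : g.IsHomLift (𝟙 t.base) (inv α₁ ≫ β₁) :=
    isHomLift_inv_comp hα₁ (by rw [Category.comp_id]; exact hβ₁)
  have e₁ : α₁ ≫ (inv α₁ ≫ β₁) = β₁ := by simp
  have e₂ : (inv α₁ ≫ β₁) ≫ β₂ = α₂ := by simp [← e]
  rw [← u.app_congr h k' inferInstance e₁, u.app_map h h' k' α₁ _ hα₁ hγ, Category.assoc,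
    ← v.map_app h' k' h'' _ β₂ hγ hβ₂, v.app_congr h' h'' inferInstance e₂]

/-- The composition of morphisms of the dependent product. -/
noncomputable def PiHom.compApp {s t r : PiObj g f hg} (u : PiHom s t) (v : PiHom t r) {a a'' : A}
    (h : g.obj a = s.base) (h'' : g.obj a'' = r.base) (α : a ⟶ a'')
    (hα : g.IsHomLift (u.base ≫ v.base) α) : s.obj a h ⟶ r.obj a'' h'' :=
  have H := exists_factorization (hg := hg) u.base v.base h α hα
  u.app h H.choose_spec.choose _ H.choose_spec.choose_spec.choose_spec.choose_spec.1 ≫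
    v.app H.choose_spec.choose h'' _ H.choose_spec.choose_spec.choose_spec.choose_spec.2.1

theorem PiHom.compApp_eq {s t r : PiObj g f hg} (u : PiHom s t) (v : PiHom t r)
    {a a' a'' : A} (h : g.obj a = s.base) (h' : g.obj a' = t.base) (h'' : g.obj a'' = r.base)
    {α : a ⟶ a''} {α₁ : a ⟶ a'} {α₂ : a' ⟶ a''} (hα : g.IsHomLift (u.base ≫ v.base) α)
    (hα₁ : g.IsHomLift u.base α₁) (hα₂ : g.IsHomLift v.base α₂) (e : α₁ ≫ α₂ = α) :
    u.compApp v h h'' α hα = u.app h h' α₁ hα₁ ≫ v.app h' h'' α₂ hα₂ :=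
  have H := exists_factorization (hg := hg) u.base v.base h α hα
  u.app_comp_app_eq v _ _ _ _ _ _ _ _
    (H.choose_spec.choose_spec.choose_spec.choose_spec.2.2.trans e.symm)

/-- The composition of morphisms of the dependent product. -/
noncomputable def PiHom.comp {s t r : PiObj g f hg} (u : PiHom s t) (v : PiHom t r) :
    PiHom s r where
  base := u.base ≫ v.base
  app h h' α hα := u.compApp v h h' α hα
  isHomLift_app h h' α hα := by
    obtain ⟨a', k, α₁, α₂, h₁, h₂, rfl⟩ := exists_factorization (hg := hg) u.base v.base h α hα
    rw [u.compApp_eq v h k h' hα h₁ h₂ rfl]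
    have := u.isHomLift_app h k α₁ h₁
    have := v.isHomLift_app k h' α₂ h₂
    infer_instance
  map_app h h' h'' γ α hγ hα := by
    obtain ⟨a', k, α₁, α₂, h₁, h₂, rfl⟩ := exists_factorization (hg := hg) u.base v.base h' α hα
    rw [u.compApp_eq v h' k h'' hα h₁ h₂ rfl, u.compApp_eq v h k h'' _ inferInstance h₂
      (Category.assoc γ α₁ α₂), u.map_app h h' k γ α₁ hγ h₁, Category.assoc]
  app_map h h' h'' α γ hα hγ := by
    obtain ⟨a', k, α₁, α₂, h₁, h₂, rfl⟩ := exists_factorization (hg := hg) u.base v.base h α hα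
    rw [u.compApp_eq v h k h' hα h₁ h₂ rfl, u.compApp_eq v h k h'' _ h₁ inferInstance
      (Category.assoc α₁ α₂ γ).symm, v.app_map k h' h'' α₂ γ h₂ hγ, Category.assoc]

/-- The inverse of a morphism of the dependent product. -/
noncomputable def PiHom.inv {s t : PiObj g f hg} (u : PiHom s t) : PiHom t s where
  base := CategoryTheory.inv u.base
  app h h' α hα := CategoryTheory.inv (u.app h' h (CategoryTheory.inv α)
    (isHomLift_inv_of hα))
  isHomLift_app h h' α hα := by
    have := u.isHomLift_app h' h (CategoryTheory.inv α) (isHomLift_inv_of hα)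
    simpa using IsHomLift.inv f (CategoryTheory.inv α) (u.app h' h (CategoryTheory.inv α) _)
  map_app h h' h'' γ α hγ hα := by
    have hα' : g.IsHomLift u.base (CategoryTheory.inv α) :=
      isHomLift_inv_of hα
    rw [u.app_congr h'' h (α' := CategoryTheory.inv α ≫ CategoryTheory.inv γ) _ (by simp),
      u.app_map h'' h' h _ _ hα' inferInstance, t.map_inv h h' γ hγ]
    simp
  app_map h h' h'' α γ hα hγ := by
    have hα' : g.IsHomLift u.base (CategoryTheory.inv α) :=
      isHomLift_inv_of hα
    rw [u.app_congr h'' h (α' := CategoryTheory.inv γ ≫ CategoryTheory.inv α) _ (by simp),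
      u.map_app h'' h' h _ _ inferInstance hα', s.map_inv h' h'' γ hγ]
    simp

noncomputable instance : Groupoid (PiObj g f hg) where
  Hom := PiHom
  id := PiHom.id
  comp := PiHom.comp
  id_comp {s t} u := PiHom.ext (Category.id_comp _) fun a a' h h' α hα hα' => by
    change (PiHom.id s).compApp u h h' α hα = _
    rw [(PiHom.id s).compApp_eq u h h h' hα (IsHomLift.id h) hα' (Category.id_comp α)]
    change s.map h h _ _ ≫ _ = _
    rw [s.map_id, Category.id_comp]
  comp_id {s t} u := PiHom.ext (Category.comp_id _) fun a a' h h' α hα hα' => by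
    change u.compApp (PiHom.id t) h h' α hα = _
    rw [u.compApp_eq (PiHom.id t) h h' h' hα hα' (IsHomLift.id h') (Category.comp_id α)]
    change _ ≫ t.map h' h' _ _ = _
    rw [t.map_id, Category.comp_id]
  assoc {s t r q} u v w := PiHom.ext (Category.assoc _ _ _) fun a a' h h' α hα hα' => by
    change (u.comp v).compApp w h h' α hα = u.compApp (v.comp w) h h' α hα'
    obtain ⟨a₂, k₂, α₁, α₂, h₁, h₂, rfl⟩ :=
      exists_factorization (hg := hg) u.base (v.base ≫ w.base) h α hα'
    obtain ⟨a₃, k₃, α₂, α₃, h₂', h₃, rfl⟩ :=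
      exists_factorization (hg := hg) v.base w.base k₂ α₂ h₂
    have h₁₂ : g.IsHomLift (u.base ≫ v.base) (α₁ ≫ α₂) := inferInstance
    rw [u.compApp_eq (v.comp w) h k₂ h' hα' h₁ h₂ rfl,
      (u.comp v).compApp_eq w h k₃ h' hα h₁₂ h₃ (Category.assoc _ _ _)]
    change u.compApp v _ _ _ h₁₂ ≫ _ = _ ≫ v.compApp w _ _ _ h₂
    rw [u.compApp_eq v h k₂ k₃ h₁₂ h₁ h₂' rfl, v.compApp_eq w k₂ k₃ h' h₂ h₂' h₃ rfl,
      Category.assoc]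
  inv := PiHom.inv
  inv_comp {s t} u := PiHom.ext (IsIso.inv_hom_id u.base) fun a a' h h' α hα hα' => by
    obtain ⟨c, k, α₁, α₂, h₁, h₂, rfl⟩ :=
      exists_factorization (hg := hg) (inv u.base) u.base h α hα
    change u.inv.compApp u h h' _ hα = t.map h h' _ hα'
    have h₁' : g.IsHomLift u.base (inv α₁) := isHomLift_inv_of h₁
    rw [u.inv.compApp_eq u h k h' hα h₁ h₂ rfl]
    change inv (u.app k h (inv α₁) _) ≫ _ = _
    rw [IsIso.inv_comp_eq, ← u.app_map k h h' _ _ h₁' hα']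
    exact u.app_congr _ _ _ (by simp)
  comp_inv {s t} u := PiHom.ext (IsIso.hom_inv_id u.base) fun a a' h h' α hα hα' => by
    obtain ⟨c, k, α₁, α₂, h₁, h₂, rfl⟩ :=
      exists_factorization (hg := hg) u.base (inv u.base) h α hα
    change u.compApp u.inv h h' _ hα = s.map h h' _ hα'
    have h₂' : g.IsHomLift u.base (inv α₂) := isHomLift_inv_of h₂
    rw [u.compApp_eq u.inv h k h' hα h₁ h₂ rfl]
    change _ ≫ inv (u.app h' k (inv α₂) _) = _
    rw [IsIso.comp_inv_eq, ← u.map_app h h' k _ _ hα' h₂']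
    exact u.app_congr _ _ _ (by simp)

end DependentProduct

/-! ### Universal property of the groupoid of sections -/

section DependentProduct

variable {A B X : Type u} [Groupoid.{u} A] [Groupoid.{u} B] [Groupoid.{u} X]
variable (g : A ⥤ B) (f : X ⥤ A) (hg : IsIsofibration g)

/-- The projection of the dependent product to the base. -/
def piProj : PiObj g f hg ⥤ B where
  obj s := s.base
  map u := PiHom.base u
  map_id _ := rfl
  map_comp _ _ := rfl

/-- The evaluation functor from the pullback of the dependent product. -/
def piEval : Pb (piProj g f hg) g ⥤ X where
  obj x := x.fst.obj x.snd x.w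
  map {x y} φ := PiHom.app φ.fst x.w y.w φ.snd φ.w
  map_id x := x.fst.map_id x.w _
  map_comp {x y z} φ ψ :=
    PiHom.compApp_eq φ.fst ψ.fst x.w y.w z.w (φ ≫ ψ).w φ.w ψ.w rfl

theorem piEval_comp : piEval g f hg ⋙ f = Pb.sndFunctor (piProj g f hg) g :=
  comp_eq_iff_isHomLift.2 fun x y φ => by
    exact PiHom.isHomLift_app φ.fst x.w y.w φ.snd φ.w

variable {g f hg}
variable {T : Type u} [Groupoid.{u} T]

variable (hg) in
/-- The functor to the dependent product corresponding to a functor out of a pullback. -/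
def piLift (k : T ⥤ B) (e : Pb k g ⥤ X) (he : e ⋙ f = Pb.sndFunctor k g) : T ⥤ PiObj g f hg where
  obj t :=
    { base := k.obj t
      obj a h := e.obj ⟨t, a, h⟩
      map {a a'} h h' α hα := e.map (X := ⟨t, a, h⟩) (Y := ⟨t, a', h'⟩)
        ⟨𝟙 t, α, isHomLift_of_eq hα (k.map_id t).symm rfl⟩
      isHomLift_map {a a'} h h' α hα :=
        comp_eq_iff_isHomLift.1 he (x := ⟨t, a, h⟩) (y := ⟨t, a', h'⟩) ⟨𝟙 t, α, _⟩
      map_comp h h' h'' α α' hα hα' := by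
        rw [← e.map_comp]
        congr 1
        exact Pb.Hom.ext (Category.comp_id _).symm rfl }
  map {t t'} τ :=
    { base := k.map τ
      app {a a'} h h' α hα := e.map (X := ⟨t, a, h⟩) (Y := ⟨t', a', h'⟩) ⟨τ, α, hα⟩
      isHomLift_app {a a'} h h' α hα :=
        comp_eq_iff_isHomLift.1 he (x := ⟨t, a, h⟩) (y := ⟨t', a', h'⟩) ⟨τ, α, hα⟩
      map_app h h' h'' γ α hγ hα := by
        dsimp only
        rw [← e.map_comp]
        congr 1
        exact Pb.Hom.ext (Category.id_comp _).symm rfl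
      app_map h h' h'' γ α hγ hα := by
        dsimp only
        rw [← e.map_comp]
        congr 1
        exact Pb.Hom.ext (Category.comp_id _).symm rfl }
  map_id t := PiHom.ext (k.map_id t) fun a a' h h' α hα hα' => rfl
  map_comp {t t' t''} τ τ' := PiHom.ext (k.map_comp τ τ') fun a a'' h h'' α hα hα' => by
    obtain ⟨a', h', α₁, α₂, h₁, h₂, rfl⟩ :=
      exists_factorization (hg := hg) (k.map τ) (k.map τ') h α hα'
    refine Eq.trans ?_ (PiHom.compApp_eq _ _ h h' h'' hα' h₁ h₂ rfl).symm
    dsimp only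
    rw [← e.map_comp]
    rfl

/-- The functor between pullbacks induced by a functor into the base. -/
noncomputable def Pb.map {k : T ⥤ B} {P : Type u} [Groupoid.{u} P] {p : P ⥤ B} (m : T ⥤ P)
    (h : m ⋙ p = k) : Pb k g ⥤ Pb p g :=
  Pb.lift (Pb.fstFunctor k g ⋙ m) (Pb.sndFunctor k g) (by
    rw [Pb.condition, Functor.assoc, h])

theorem piLift_comp_piProj (k : T ⥤ B) (e : Pb k g ⥤ X) (he : e ⋙ f = Pb.sndFunctor k g) :
    piLift hg k e he ⋙ piProj g f hg = k := rfl

theorem map_piLift_comp_piEval (k : T ⥤ B) (e : Pb k g ⥤ X) (he : e ⋙ f = Pb.sndFunctor k g) :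
    Pb.map (piLift hg k e he) (piLift_comp_piProj k e he) ⋙ piEval g f hg = e := by
  exact CategoryTheory.Functor.hext (fun x => rfl) fun x y φ => HEq.rfl

/-- The base and the object part are shared, so no heterogeneous equality between the `map` fields
is needed. -/
theorem PiObj.mk_congr {base : B} {obj : ∀ a : A, g.obj a = base → X}
    {map map' : ∀ {a a' : A} (h : g.obj a = base) (h' : g.obj a' = base) (α : a ⟶ a')
      (_ : g.IsHomLift (𝟙 base) α), obj a h ⟶ obj a' h'} {h₁ h₂ h₁' h₂'}
    (h : ∀ (a a' : A) (h : g.obj a = base) (h' : g.obj a' = base) (α : a ⟶ a')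
      (hα : g.IsHomLift (𝟙 base) α), map h h' α hα = map' h h' α hα) :
    PiObj.mk (f := f) (hg := hg) base obj map h₁ h₂ = PiObj.mk base obj map' h₁' h₂' := by
  obtain rfl : @map = @map' := by
    funext a a' k k' α hα
    exact h a a' k k' α hα
  rfl

theorem PiHom.hext {s t s' t' : PiObj g f hg} {u : PiHom s t} {v : PiHom s' t'} (hs : s = s')
    (ht : t = t') (hb : HEq u.base v.base)
    (happ : ∀ (a a' : A) (h : g.obj a = s.base) (k : g.obj a = s'.base) (h' : g.obj a' = t.base)
      (k' : g.obj a' = t'.base) (α : a ⟶ a') (hα : g.IsHomLift u.base α)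
      (hα' : g.IsHomLift v.base α), HEq (u.app h h' α hα) (v.app k k' α hα')) : HEq u v := by
  subst hs ht
  exact heq_of_eq (PiHom.ext (eq_of_heq hb) fun a a' h h' α hα hα' =>
    eq_of_heq (happ a a' h h h' h' α hα hα'))

theorem pi_functor_ext {k : T ⥤ B} {m m' : T ⥤ PiObj g f hg}
    (h : m ⋙ piProj g f hg = k) (h' : m' ⋙ piProj g f hg = k)
    (e : Pb.map m h ⋙ piEval g f hg = Pb.map m' h' ⋙ piEval g f hg) : m = m' := by
  have hk : ∀ (n : T ⥤ PiObj g f hg) (hn : n ⋙ piProj g f hg = k),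
      (Pb.map n hn ⋙ piEval g f hg) ⋙ f = Pb.sndFunctor k g := by
    intro n hn
    rw [Functor.assoc, piEval_comp]
    rfl
  have key : ∀ (n : T ⥤ PiObj g f hg) (hn : n ⋙ piProj g f hg = k),
      n = piLift hg k (Pb.map n hn ⋙ piEval g f hg) (hk n hn) := by
    intro n hn
    subst hn
    have hobj : ∀ t, n.obj t = (piLift hg (n ⋙ piProj g f hg)
        (Pb.map n rfl ⋙ piEval g f hg) (hk n rfl)).obj t := fun t =>
      PiObj.mk_congr fun a a' h h' α hα => by
        -- In the reconstructed section, `map` is the `app` of `n.map (𝟙 t)`. Generalizing this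
        -- morphism to `u` allows substituting `u = 𝟙 _`, whose `app` is the original `map`.
        have : ∀ (u : n.obj t ⟶ n.obj t) (hu : u = 𝟙 _) (hα' : g.IsHomLift (PiHom.base u) α),
            (n.obj t).map h h' α hα = PiHom.app u h h' α hα' := by
          rintro _ rfl _
          rfl
        exact this _ (n.map_id t) _
    exact CategoryTheory.Functor.hext hobj fun t t' τ =>
      PiHom.hext (hobj t) (hobj t') HEq.rfl fun a a' h k h' k' α hα hα' => HEq.rfl
  rw [key m h, key m' h']
  congr 1

end DependentProduct

/-- The section `s` is transported along `β` by conjugation: points over `b` are moved back to the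
old fiber by lifts `ρ` of `inv β`, `s` is evaluated there, and the values are moved forward by lifts
`κ` of `inv ρ` along `f`. -/
theorem isIsofibration_piProj {A B X : Type u} [Groupoid.{u} A] [Groupoid.{u} B] [Groupoid.{u} X]
    {g : A ⥤ B} {f : X ⥤ A} (hg : IsIsofibration g) (hf : IsIsofibration f) :
    IsIsofibration (piProj g f hg) := by
  refine isIsofibration_of_exists_isHomLift fun (s : PiObj g f hg) b β => ?_
  change s.base ⟶ b at β
  choose r ρ hρ using fun (a : A) (h : g.obj a = b) => hg.exists_isHomLift (inv β) h
  have hr (a : A) (h : g.obj a = b) : g.obj (r a h) = s.base :=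
    IsHomLift.codomain_eq g (inv β) (ρ a h)
  have hs (a : A) (h : g.obj a = s.base) : f.obj (s.obj a h) = a :=
    have := s.isHomLift_map h h (𝟙 a) (IsHomLift.id h)
    IsHomLift.domain_eq f (𝟙 a) (s.map h h (𝟙 a) (IsHomLift.id h))
  choose x κ hκ using fun (a : A) (h : g.obj a = b) =>
    hf.exists_isHomLift (inv (ρ a h)) (hs (r a h) (hr a h))
  have hconj {a a' : A} (h : g.obj a = b) (h' : g.obj a' = b) (γ : a ⟶ a')
      (hγ : g.IsHomLift (𝟙 b) γ) : g.IsHomLift (𝟙 s.base) (inv (ρ a h) ≫ γ ≫ ρ a' h') :=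
    isHomLift_inv_comp (hρ a h) (isHomLift_of_eq (β := 𝟙 b ≫ inv β) inferInstance (by simp) rfl)
  have happ {a a' : A} (h' : g.obj a' = b) (α : a ⟶ a') (hα : g.IsHomLift β α) :
      g.IsHomLift (𝟙 s.base) (α ≫ ρ a' h') :=
    isHomLift_of_eq (β := β ≫ inv β) inferInstance (by simp) rfl
  let t : PiObj g f hg :=
    { base := b
      obj := x
      map {a a'} h h' γ hγ := inv (κ a h) ≫ s.map (hr a h) (hr a' h')
        (inv (ρ a h) ≫ γ ≫ ρ a' h') (hconj h h' γ hγ) ≫ κ a' h'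
      isHomLift_map {a a'} h h' γ hγ := by
        have := s.isHomLift_map (hr a h) (hr a' h') _ (hconj h h' γ hγ)
        have h₁ := isHomLift_inv_of (hκ a h)
        exact isHomLift_of_eq
          (β := ρ a h ≫ (inv (ρ a h) ≫ γ ≫ ρ a' h') ≫ inv (ρ a' h')) inferInstance (by simp) rfl
      map_comp {a a' a''} h h' h'' γ γ' hγ hγ' := by
        simp only [Category.assoc, IsIso.hom_inv_id_assoc]
        rw [← Category.assoc (s.map _ _ _ _) (s.map _ _ _ _), ← s.map_comp,
          s.map_congr _ _ _
            (α := (inv (ρ a h) ≫ γ ≫ ρ a' h') ≫ inv (ρ a' h') ≫ γ' ≫ ρ a'' h'')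
            (α' := inv (ρ a h) ≫ γ ≫ γ' ≫ ρ a'' h'') (by simp)] }
  -- Composing `α` with `ρ` lands in the fiber over `s.base`, where `s.map` applies; `κ` then
  -- returns to the value of `t`.
  let u : s ⟶ t := PiHom.mk (s := s) (t := t) β
    (fun {a a'} h h' α hα => s.map h (hr a' h') (α ≫ ρ a' h') (happ h' α hα) ≫ κ a' h')
    (fun {a a'} h h' α hα => by
      have := s.isHomLift_map h (hr a' h') _ (happ h' α hα)
      exact isHomLift_of_eq (β := (α ≫ ρ a' h') ≫ inv (ρ a' h')) inferInstance (by simp) rfl)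
    (fun {a a' a''} h h' h'' γ α hγ hα => by
      have := happ h'' α hα
      rw [← Category.assoc, ← s.map_comp h h' (hr a'' h'') γ (α ≫ ρ a'' h''),
        s.map_congr _ _ _ (Category.assoc γ α _)])
    (fun {a a' a''} h h' h'' α γ hα hγ => by
      have h₁ := happ h' α hα
      have h₂ := hconj h' h'' γ hγ
      change _ = (_ ≫ _) ≫ inv (κ a' h') ≫ s.map _ _ _ _ ≫ κ a'' h''
      simp only [Category.assoc, IsIso.hom_inv_id_assoc]
      rw [← Category.assoc (s.map _ _ _ _) (s.map _ _ _ _), ← s.map_comp,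
        s.map_congr _ _ _ (α := (α ≫ ρ a' h') ≫ inv (ρ a' h') ≫ γ ≫ ρ a'' h'')
          (α' := α ≫ γ ≫ ρ a'' h'') (by simp)])
  exact ⟨t, u, Functor.IsHomLift.map (p := piProj g f hg) u⟩

/-! ### Dependent products in a category and in diagrams over a groupoid -/

section Abstract

universe v₁ u₁ v₂ u₂

variable {C : Type u₁} [Category.{v₁} C]

/-- A dependent product of `f : X ⟶ A` along `g : A ⟶ B`, given by its universal property with
respect to all pullback squares. -/
structure PiDatum {A B X : C} (g : A ⟶ B) (f : X ⟶ A) where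
  pt : C
  proj : pt ⟶ B
  pb : C
  fst : pb ⟶ pt
  snd : pb ⟶ A
  isPullback : IsPullback fst snd proj g
  eval : pb ⟶ X
  eval_comp : eval ≫ f = snd
  exists_lift {T S : C} {k : T ⟶ B} {q : S ⟶ T} {r : S ⟶ A} (_ : IsPullback q r k g) (e : S ⟶ X)
    (_ : e ≫ f = r) : ∃ (m : T ⟶ pt) (n : S ⟶ pb), m ≫ proj = k ∧ n ≫ fst = q ≫ m ∧
      n ≫ snd = r ∧ n ≫ eval = e
  hom_ext {T S : C} {k : T ⟶ B} {q : S ⟶ T} {r : S ⟶ A} (_ : IsPullback q r k g) {m m' : T ⟶ pt}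
    {n n' : S ⟶ pb} (_ : m ≫ proj = k) (_ : m' ≫ proj = k) (_ : n ≫ fst = q ≫ m)
    (_ : n' ≫ fst = q ≫ m') (_ : n ≫ snd = r) (_ : n' ≫ snd = r)
    (_ : n ≫ eval = n' ≫ eval) : m = m'

namespace PiDatum

/-- A dependent product represents the presheaf defining the partial right adjoint of
the pullback functor. -/
noncomputable def representableBy {A B : C} {g : A ⟶ B} [HasPullbacksAlong g] {f : Over A}
    (D : PiDatum g f.hom) :
    ((Over.pullback g).op ⋙ yoneda.obj f).RepresentableBy (Over.mk D.proj) := by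
  let n {T : Over B} (m : T ⟶ Over.mk D.proj) : pullback T.hom g ⟶ D.pb :=
    D.isPullback.lift (pullback.fst _ _ ≫ m.left) (pullback.snd _ _) (by
      have := Over.w m
      dsimp at this
      rw [Category.assoc, this, pullback.condition])
  have hn₁ {T : Over B} (m : T ⟶ Over.mk D.proj) : n m ≫ D.fst = pullback.fst _ _ ≫ m.left :=
    D.isPullback.lift_fst _ _ _
  have hn₂ {T : Over B} (m : T ⟶ Over.mk D.proj) : n m ≫ D.snd = pullback.snd _ _ :=
    D.isPullback.lift_snd _ _ _
  let φ {T : Over B} (m : T ⟶ Over.mk D.proj) : (Over.pullback g).obj T ⟶ f :=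
    Over.homMk (n m ≫ D.eval) (by
      rw [Category.assoc, D.eval_comp, hn₂]; rfl)
  have hφ (T : Over B) : Function.Bijective (φ (T := T)) := by
    constructor
    · intro m m' h
      ext
      exact D.hom_ext (IsPullback.of_hasPullback T.hom g) (Over.w m) (Over.w m') (hn₁ m) (hn₁ m')
        (hn₂ m) (hn₂ m') (congrArg (fun x => x.left) h)
    · intro e
      obtain ⟨m, n', h₁, h₂, h₃, h₄⟩ := D.exists_lift (IsPullback.of_hasPullback T.hom g) e.left
        (Over.w e)
      refine ⟨Over.homMk m h₁, ?_⟩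
      ext
      refine Eq.trans ?_ h₄
      change n _ ≫ D.eval = _
      congr 1
      apply D.isPullback.hom_ext
      · rw [hn₁, h₂]; rfl
      · rw [hn₂, h₃]
  exact
    { homEquiv {T} := Equiv.ofBijective (φ (T := T)) (hφ T)
      homEquiv_comp {T T'} t m := by
        change φ (t ≫ m) = (Over.pullback g).map t ≫ φ m
        ext
        change n (t ≫ m) ≫ D.eval = pullback.lift _ _ _ ≫ n m ≫ D.eval
        rw [← Category.assoc]
        congr 1
        apply D.isPullback.hom_ext
        · rw [hn₁, Category.assoc, hn₁, pullback.lift_fst_assoc, Over.comp_left, Category.assoc]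
        · rw [hn₂, Category.assoc, hn₂, pullback.lift_snd] }

end PiDatum

section FunctorCategory

variable {J : Type u₂} [Groupoid.{v₂} J] [HasPullbacks C] {A B X : J ⥤ C} {g : A ⟶ B} {f : X ⟶ A}

omit [HasPullbacks C] in
-- Both horizontal maps are invertible because `J` is a groupoid; this is what lets dependent
-- products be computed objectwise.
theorem isPullback_naturality (g : A ⟶ B) {i j : J} (h : i ⟶ j) :
    IsPullback (A.map h) (g.app i) (g.app j) (B.map h) :=
  IsPullback.of_horiz_isIso ⟨g.naturality h⟩

variable (D : ∀ j, PiDatum (g.app j) (f.app j))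

omit [HasPullbacks C] in
theorem PiDatum.isPullback_map {i j : J} (h : i ⟶ j) :
    IsPullback (D i).fst ((D i).snd ≫ A.map h) ((D i).proj ≫ B.map h) (g.app j) :=
  ((D i).isPullback.flip.paste_horiz (isPullback_naturality g h)).flip

omit [HasPullbacks C] in
-- The pullback square at `i`, pasted with the naturality square of `g`, is a test square for the
-- universal property at `j`. This yields the transition maps, and uniqueness makes them functorial.
theorem PiDatum.exists_map {i j : J} (h : i ⟶ j) :
    ∃ (m : (D i).pt ⟶ (D j).pt) (n : (D i).pb ⟶ (D j).pb), m ≫ (D j).proj = (D i).proj ≫ B.map h ∧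
      n ≫ (D j).fst = (D i).fst ≫ m ∧ n ≫ (D j).snd = (D i).snd ≫ A.map h ∧
      n ≫ (D j).eval = (D i).eval ≫ X.map h :=
  (D j).exists_lift (PiDatum.isPullback_map D h) ((D i).eval ≫ X.map h) (by
    rw [Category.assoc, f.naturality, ← Category.assoc, (D i).eval_comp])

/-- Dependent products in a category of functors out of a groupoid are computed objectwise. -/
theorem PiDatum.exists_functor :
    ∃ E : PiDatum g f, ∀ W : MorphismProperty C, (∀ j, W (D j).proj) →
      W.functorCategory J E.proj := by
  choose m n h₁ h₂ h₃ h₄ using fun {i j : J} (h : i ⟶ j) => PiDatum.exists_map D h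
  have hid (i : J) : m (𝟙 i) = 𝟙 _ := by
    refine (D i).hom_ext (PiDatum.isPullback_map D (𝟙 i)) (n := n (𝟙 i)) (n' := 𝟙 _) (h₁ _) ?_
      (h₂ _) ?_ (h₃ _) ?_ ?_ <;> simp [h₄]
  have hcomp {i j k : J} (h : i ⟶ j) (h' : j ⟶ k) : m (h ≫ h') = m h ≫ m h' := by
    refine (D k).hom_ext (PiDatum.isPullback_map D (h ≫ h')) (n := n (h ≫ h')) (n' := n h ≫ n h')
      (h₁ _) ?_ (h₂ _) ?_ (h₃ _) ?_ ?_
    · simp [h₁, reassoc_of% (h₁ h)]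
    · simp [h₂, reassoc_of% (h₂ h)]
    · simp [h₃, reassoc_of% (h₃ h)]
    · simp [h₄, reassoc_of% (h₄ h)]
  let P : J ⥤ C := { obj j := (D j).pt, map h := m h, map_id := hid, map_comp := hcomp }
  let Q : J ⥤ C :=
    { obj j := (D j).pb
      map h := n h
      map_id i := (D i).isPullback.hom_ext (by simp [h₂, hid]) (by simp [h₃])
      map_comp {i j k} h h' := (D k).isPullback.hom_ext
        (by simp [h₂, hcomp, reassoc_of% (h₂ h)]) (by simp [h₃, reassoc_of% (h₃ h)]) }
  let p : P ⟶ B := { app j := (D j).proj, naturality i j h := h₁ h }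
  let q : Q ⟶ P := { app j := (D j).fst, naturality i j h := h₂ h }
  let r : Q ⟶ A := { app j := (D j).snd, naturality i j h := h₃ h }
  let ε : Q ⟶ X := { app j := (D j).eval, naturality i j h := h₄ h }
  refine ⟨{ pt := P, proj := p, pb := Q, fst := q, snd := r, eval := ε, isPullback := ?_,
            eval_comp := ?_, exists_lift := ?_, hom_ext := ?_ }, fun W h j => h j⟩
  · exact IsPullback.iff_app.2 fun j => (D j).isPullback
  · ext j
    exact (D j).eval_comp
  · intro T S k q' r' sq e he
    choose m' n' k₁ k₂ k₃ k₄ using fun j => (D j).exists_lift (sq.app j) (e.app j)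
      (congr_app he j)
    have hm {i j : J} (h : i ⟶ j) : T.map h ≫ m' j = m' i ≫ m h := by
      have sq' : IsPullback (q'.app i) (r'.app i ≫ A.map h) (k.app i ≫ B.map h) (g.app j) :=
        ((sq.app i).flip.paste_horiz (isPullback_naturality g h)).flip
      refine (D j).hom_ext sq' (n := S.map h ≫ n' j) (n' := n' i ≫ n h) ?_ ?_ ?_ ?_ ?_ ?_ ?_
      · simp [k₁]
      · simp [h₁, reassoc_of% (k₁ i)]
      · simp [k₂]
      · simp [h₂, reassoc_of% (k₂ i)]
      · simp [k₃]
      · simp [h₃, reassoc_of% (k₃ i)]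
      · simp [k₄, h₄, reassoc_of% (k₄ i)]
    have hn {i j : J} (h : i ⟶ j) : S.map h ≫ n' j = n' i ≫ n h := by
      apply (D j).isPullback.hom_ext
      · simp [k₂, h₂, reassoc_of% (k₂ i), hm]
      · simp [k₃, h₃, reassoc_of% (k₃ i)]
    refine ⟨{ app := m', naturality i j h := hm h }, { app := n', naturality i j h := hn h },
      ?_, ?_, ?_, ?_⟩
    · ext j; exact k₁ j
    · ext j; exact k₂ j
    · ext j; exact k₃ j
    · ext j; exact k₄ j
  · intro T S k q' r' sq m₁ m₂ n₁ n₂ e₁ e₂ e₃ e₄ e₅ e₆ e₇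
    ext j
    exact (D j).hom_ext (sq.app j) (congr_app e₁ j) (congr_app e₂ j) (congr_app e₃ j)
      (congr_app e₄ j) (congr_app e₅ j) (congr_app e₆ j) (congr_app e₇ j)

end FunctorCategory

end Abstract

/-- The dependent product along an isofibration of groupoids. -/
noncomputable def grpdPiDatum {A B X : Type u} [Groupoid.{u} A] [Groupoid.{u} B] [Groupoid.{u} X]
    (g : A ⥤ B) (f : X ⥤ A) (hg : IsIsofibration g) :
    PiDatum (C := Grpd.{u, u}) (A := Grpd.of A) (B := Grpd.of B) (X := Grpd.of X) g f where
  pt := Grpd.of (PiObj g f hg)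
  proj := piProj g f hg
  pb := Grpd.of (Pb (piProj g f hg) g)
  fst := Pb.fstFunctor _ _
  snd := Pb.sndFunctor _ _
  isPullback := isPullback_pb (A := Grpd.of A) (B := Grpd.of B) (T := Grpd.of (PiObj g f hg))
    (piProj g f hg) g
  eval := piEval g f hg
  eval_comp := piEval_comp g f hg
  exists_lift {T S k q r} sq e he := by
    let k' : T ⥤ B := k
    have hp := isPullback_pb (A := Grpd.of A) (B := Grpd.of B) (T := T) k g
    -- An arbitrary pullback square is compared with the strict one, where the lift is explicit.
    let i := hp.isoIsPullback _ _ sq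
    have he' : Functor.comp (C := Pb k' g) (i.hom ≫ e) f = Pb.sndFunctor k' g :=
      (congrArg (fun x => i.hom ≫ x) he).trans (hp.isoIsPullback_hom_snd _ _ sq)
    refine ⟨piLift hg k' (i.hom ≫ e) he',
      i.inv ≫ Pb.map (piLift hg k' _ he') (piLift_comp_piProj k' _ he'), rfl, ?_, ?_, ?_⟩
    · let l : T ⟶ Grpd.of (PiObj g f hg) := piLift hg k' (i.hom ≫ e) he'
      exact congrArg (fun x => x ≫ l)
        (hp.isoIsPullback_inv_fst _ _ sq)
    · exact hp.isoIsPullback_inv_snd _ _ sq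
    · exact (congrArg (fun x => i.inv ≫ x)
        (map_piLift_comp_piEval (hg := hg) k' (i.hom ≫ e) he')).trans (Iso.inv_hom_id_assoc i e)
  hom_ext {T S k q r} sq m m' n n' h₁ h₂ h₃ h₄ h₅ h₆ h₇ := by
    have hp := isPullback_pb (A := Grpd.of A) (B := Grpd.of B) (T := T) k g
    let i := hp.isoIsPullback _ _ sq
    have key (m : T ⟶ Grpd.of (PiObj g f hg)) (n : S ⟶ Grpd.of (Pb (piProj g f hg) g))
        (h₁ : m ≫ piProj g f hg = k) (h₂ : n ≫ Pb.fstFunctor _ _ = q ≫ m)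
        (h₃ : n ≫ Pb.sndFunctor _ _ = r) : i.hom ≫ n = Pb.map m h₁ :=
      Pb.functor_ext
        ((congrArg (fun x => i.hom ≫ x) h₂).trans
          (congrArg (fun x => x ≫ m) (hp.isoIsPullback_hom_fst _ _ sq)))
        ((congrArg (fun x => i.hom ≫ x) h₃).trans (hp.isoIsPullback_hom_snd _ _ sq))
    exact pi_functor_ext h₁ h₂
      ((congrArg (fun x => x ⋙ piEval g f hg) (key m n h₁ h₃ h₅)).symm.trans
        ((congrArg (fun x => i.hom ≫ x) h₇).trans
          (congrArg (fun x => x ⋙ piEval g f hg) (key m' n' h₂ h₄ h₆))))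

/-! ### The walking isomorphism and isofibrations as a right lifting class -/

/-- The groupoid with two objects and a unique isomorphism between them. -/
def Interval : Type u := ULift.{u} Bool

namespace Interval

instance : Groupoid.{u} Interval.{u} where
  Hom _ _ := PUnit
  id _ := ⟨⟩
  comp _ _ := ⟨⟩
  inv _ := ⟨⟩

/-- The source of the walking isomorphism. -/
def left : Interval.{u} := ⟨false⟩

/-- The target of the walking isomorphism. -/
def right : Interval.{u} := ⟨true⟩

/-- The walking isomorphism. -/
def hom : left.{u} ⟶ right.{u} := PUnit.unit

variable {E : Type*} [Groupoid E]

/-- The object map of the functor out of the interval picking a morphism. -/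
def objOf (a b : E) : Interval.{u} → E
  | ⟨false⟩ => a
  | ⟨true⟩ => b

/-- The morphism from the source to the images of the objects of the interval. -/
def legOf {a b : E} (φ : a ⟶ b) : ∀ i : Interval.{u}, a ⟶ objOf a b i
  | ⟨false⟩ => 𝟙 a
  | ⟨true⟩ => φ

/-- The functor out of the interval picking a morphism. -/
noncomputable def functorOf {a b : E} (φ : a ⟶ b) : Interval.{u} ⥤ E where
  obj := objOf a b
  map {i j} _ := inv (legOf φ i) ≫ legOf φ j
  map_id i := by simp
  map_comp f g := by simp

@[simp]
theorem functorOf_map_hom {a b : E} (φ : a ⟶ b) : (functorOf.{u} φ).map hom = φ := by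
  change inv (𝟙 a) ≫ φ = φ
  simp

theorem functor_hext {F G : Interval.{u} ⥤ E} (h₀ : F.obj left = G.obj left)
    (h₁ : F.obj right = G.obj right) (h : HEq (F.map hom) (G.map hom)) : F = G := by
  have key (F : Interval.{u} ⥤ E) : F = functorOf (F.map hom) := by
    refine CategoryTheory.Functor.hext ?_ ?_
    · rintro ⟨_ | _⟩ <;> rfl
    · rintro ⟨_ | _⟩ ⟨_ | _⟩ ⟨⟩
      · refine heq_of_eq ((F.map_id left).trans ?_)
        change _ = inv (𝟙 _) ≫ 𝟙 _
        simp
      · refine heq_of_eq ?_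
        change F.map hom = inv (𝟙 _) ≫ F.map hom
        simp
      · refine heq_of_eq ?_
        change F.map (inv hom) = inv (F.map hom) ≫ 𝟙 _
        simp
      · refine heq_of_eq ((F.map_id right).trans ?_)
        change _ = inv (F.map hom) ≫ F.map hom
        simp
  have congr {a b a' b' : E} (φ : a ⟶ b) (φ' : a' ⟶ b') (h₀ : a = a') (h₁ : b = b')
      (h : HEq φ φ') : functorOf.{u} φ = functorOf φ' := by
    subst h₀ h₁
    rw [eq_of_heq h]
  rw [key F, key G]
  exact congr _ _ h₀ h₁ h

end Interval

/-- The inclusion of an endpoint into the interval. -/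
def intervalLeft : Grpd.of (Discrete PUnit.{u + 1}) ⟶ Grpd.of Interval.{u} :=
  Functor.fromPUnit Interval.left

theorem fromPUnit_eq {E : Type*} [Category* E] (F : Discrete PUnit.{u + 1} ⥤ E) :
    F = Functor.fromPUnit (F.obj ⟨⟨⟩⟩) := by
  refine CategoryTheory.Functor.hext (fun _ => rfl) ?_
  rintro ⟨⟨⟩⟩ ⟨⟨⟩⟩ f
  obtain rfl : f = 𝟙 _ := Subsingleton.elim _ _
  rw [CategoryTheory.Functor.map_id, CategoryTheory.Functor.map_id]
  exact HEq.rfl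

theorem IsIsofibration.exists_lift {E B : Type*} [Groupoid E] [Groupoid B] {p : E ⥤ B}
    (hp : IsIsofibration p) (a : Discrete PUnit.{u + 1} ⥤ E) (b : Interval.{u} ⥤ B)
    (w : a ⋙ p = Functor.fromPUnit Interval.left ⋙ b) :
    ∃ l : Interval.{u} ⥤ E, Functor.fromPUnit Interval.left ⋙ l = a ∧ l ⋙ p = b := by
  obtain ⟨e, ψ, hψ⟩ := hp.exists_isHomLift (b := b.obj Interval.left) (b' := b.obj Interval.right)
    (b.map Interval.hom) (Functor.congr_obj w ⟨⟨⟩⟩)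
  refine ⟨Interval.functorOf ψ, ?_, ?_⟩
  · exact (fromPUnit_eq (Functor.fromPUnit Interval.left ⋙ Interval.functorOf ψ)).trans
      (fromPUnit_eq a).symm
  · have h₀ := IsHomLift.domain_eq p (b.map Interval.hom) ψ
    have h₁ := IsHomLift.codomain_eq p (b.map Interval.hom) ψ
    refine Interval.functor_hext h₀ h₁ ?_
    rw [Functor.comp_map, Interval.functorOf_map_hom]
    exact (conj_eqToHom_iff_heq _ _ h₀ h₁).1 (IsHomLift.fac' p (b.map Interval.hom) ψ)

theorem isIsofibration_of_exists_lift {E B : Type*} [Groupoid E] [Groupoid B] {p : E ⥤ B}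
    (hp : ∀ (a : Discrete PUnit.{u + 1} ⥤ E) (b : Interval.{u} ⥤ B)
      (_ : a ⋙ p = Functor.fromPUnit Interval.left ⋙ b),
      ∃ l : Interval.{u} ⥤ E, Functor.fromPUnit Interval.left ⋙ l = a ∧ l ⋙ p = b) :
    IsIsofibration p := by
  refine isIsofibration_of_exists_isHomLift fun a b φ => ?_
  obtain ⟨l, h₁, h₂⟩ := hp (Functor.fromPUnit a) (Interval.functorOf φ)
    ((fromPUnit_eq (Functor.fromPUnit a ⋙ p)).trans
      (fromPUnit_eq (Functor.fromPUnit Interval.left ⋙ Interval.functorOf φ)).symm)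
  have h₀ : l.obj Interval.left = a := Functor.congr_obj h₁ ⟨⟨⟩⟩
  have h₃ := comp_eq_iff_isHomLift.1 h₂ Interval.hom
  rw [Interval.functorOf_map_hom] at h₃
  have h₄ : p.IsHomLift φ (l.map Interval.hom) := h₃
  exact ⟨l.obj Interval.right, eqToHom h₀.symm ≫ l.map Interval.hom, inferInstance⟩

theorem isofibrations_iff_hasLiftingProperty {E B : Grpd.{u, u}} (p : E ⟶ B) :
    isofibrations p ↔ HasLiftingProperty intervalLeft.{u} p := by
  constructor
  · intro hp
    refine ⟨fun {a b} sq => ?_⟩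
    obtain ⟨l, h₁, h₂⟩ := IsIsofibration.exists_lift hp a b sq.w
    exact ⟨⟨⟨l, h₁, h₂⟩⟩⟩
  · intro hp
    refine isIsofibration_of_exists_lift fun a b w => ?_
    have sq : CommSq (C := Grpd.{u, u}) a intervalLeft.{u} p b := ⟨w⟩
    have := hp.sq_hasLift sq
    exact ⟨sq.lift, sq.fac_left, sq.fac_right⟩

theorem isofibrations_eq_rlp :
    isofibrations.{u} = (MorphismProperty.ofHoms (fun _ : Unit => intervalLeft.{u})).rlp := by
  ext E B p
  rw [isofibrations_iff_hasLiftingProperty]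
  constructor
  · rintro h _ _ _ ⟨⟩
    exact h
  · intro h
    exact h _ ⟨()⟩

instance : isofibrations.{u}.IsMultiplicative := by
  rw [isofibrations_eq_rlp]; infer_instance

instance : isofibrations.{u}.IsStableUnderBaseChange := by
  rw [isofibrations_eq_rlp]; infer_instance

/-- Groupoids are reflective in categories. -/
instance : Reflective Grpd.forgetToCat.{u, u} where
  L := Grpd.free
  adj := Grpd.freeForgetAdjunction

instance : HasColimitsOfSize.{u, u} Grpd.{u, u} :=
  hasColimits_of_reflective Grpd.forgetToCat.{u, u}

instance : HasTerminal Grpd.{u, u} :=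
  hasLimitsOfShape_of_reflective Grpd.forgetToCat.{u, u}

/-! ### Essential images of acyclic cofibrations -/

section EssentialImage

instance {C : Type*} [Groupoid C] (P : ObjectProperty C) : Groupoid P.FullSubcategory where
  inv f := ObjectProperty.homMk (Groupoid.inv f.hom)
  inv_comp f := by ext; simp
  comp_inv f := by ext; simp

theorem fullSubcategory_functor_ext {C D : Type*} [Category* C] [Category* D]
    {P : ObjectProperty D} {F G : C ⥤ P.FullSubcategory} (h : F ⋙ P.ι = G ⋙ P.ι) : F = G := by
  have key (H : C ⥤ P.FullSubcategory) : H = P.lift (H ⋙ P.ι) fun x => (H.obj x).property := rfl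
  rw [key F, key G]
  congr 1

variable {J : Type*} [Category* J] {X Y : J ⥤ Grpd.{u, u}} (i : X ⟶ Y)

/-- The property of being connected to an object in the image of a natural transformation. -/
def connectedToImage (j : J) : ObjectProperty (Y.obj j) :=
  fun y => ∃ x : X.obj j, Nonempty (Functor.obj (i.app j) x ⟶ y)

theorem connectedToImage_map {j k : J} (h : j ⟶ k) {y : Y.obj j} (hy : connectedToImage i j y) :
    connectedToImage i k (Functor.obj (Y.map h) y) := by
  obtain ⟨x, ⟨φ⟩⟩ := hy
  have : Functor.obj (i.app k) (Functor.obj (X.map h) x) =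
      Functor.obj (Y.map h) (Functor.obj (i.app j) x) :=
    Functor.congr_obj (i.naturality h) x
  exact ⟨Functor.obj (X.map h) x, ⟨eqToHom this ≫ CategoryTheory.Functor.map (Y.map h) φ⟩⟩

/-- The essential image of a morphism of diagrams of groupoids. -/
def essentialImage : J ⥤ Grpd.{u, u} where
  obj j := Grpd.of (connectedToImage i j).FullSubcategory
  map {j k} h := (connectedToImage i k).lift ((connectedToImage i j).ι ⋙ Y.map h)
    fun y => connectedToImage_map i h y.property
  map_id j := fullSubcategory_functor_ext
    (congrArg (fun F => (connectedToImage i j).ι ⋙ F) (Y.map_id j))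
  map_comp {j _ _} h h' := fullSubcategory_functor_ext
    (congrArg (fun F => (connectedToImage i j).ι ⋙ F) (Y.map_comp h h'))

/-- The inclusion of the essential image. -/
def essentialImageι : essentialImage i ⟶ Y where
  app j := (connectedToImage i j).ι
  naturality _ _ _ := rfl

/-- The factorization of a morphism through its essential image. -/
def toEssentialImage : X ⟶ essentialImage i where
  app j := (connectedToImage i j).lift (i.app j) fun x => ⟨x, ⟨𝟙 _⟩⟩
  naturality _ _ h := fullSubcategory_functor_ext (i.naturality h)

theorem toEssentialImage_comp : toEssentialImage i ≫ essentialImageι i = i := rfl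

theorem isofibrations_essentialImageι :
    isofibrations.functorCategory J (essentialImageι i) := by
  intro j
  refine isIsofibration_of_exists_isHomLift (F := (connectedToImage i j).ι) fun a b φ => ?_
  obtain ⟨x, ⟨ψ⟩⟩ := a.property
  let φ' : a ⟶ ⟨b, x, ⟨ψ ≫ φ⟩⟩ := ObjectProperty.homMk φ
  exact ⟨_, φ', Functor.IsHomLift.map (p := (connectedToImage i j).ι) φ'⟩

/-- The inclusion of the essential image is a fibration, so lifting `i` against it gives a section
of this inclusion; hence every object of `Y` lies in the essential image. -/
theorem connectedToImage_of_llp (hi : (isofibrations.functorCategory J).llp i) (j : J)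
    (y : Y.obj j) : connectedToImage i j y := by
  have := hi _ (isofibrations_essentialImageι i)
  have sq : CommSq (toEssentialImage i) i (essentialImageι i) (𝟙 Y) :=
    ⟨by simp [toEssentialImage_comp]⟩
  have h : Functor.obj ((sq.lift ≫ essentialImageι i).app j) y = y := by
    rw [sq.fac_right]; rfl
  rw [← h]
  exact ObjectProperty.FullSubcategory.property (P := connectedToImage i j)
    (Functor.obj (sq.lift.app j) y)

end EssentialImage

/-! ### Factorization by attaching free intervals -/

section Factorization

instance (a b : SingleObj (Multiplicative (ZMod 2))) :
    HasCoproductsOfShape (a ⟶ b) Grpd.{u, u} := by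
  have := hasColimitsOfSizeShrink.{0, 0, u, u} Grpd.{u, u}
  infer_instance

variable {X Y : GpdZ2.{u}} (f : X ⟶ Y)

/-- The object of the one-object groupoid. -/
abbrev star : SingleObj (Multiplicative (ZMod 2)) := SingleObj.star _

theorem projectiveFibrations_iff {X Y : GpdZ2.{u}} (f : X ⟶ Y) :
    projectiveFibrations f ↔ isofibrations (f.app star) :=
  ⟨fun h => h star, fun h _ => h⟩

/-- The free involutive groupoid on a groupoid. -/
noncomputable abbrev freeZ2 : Grpd.{u, u} ⥤ GpdZ2.{u} := evaluationLeftAdjoint Grpd.{u, u} star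

/-- The adjunction between the free involutive groupoid and the underlying groupoid. -/
noncomputable abbrev freeZ2Adj : freeZ2.{u} ⊣ (evaluation _ _).obj star :=
  evaluationAdjunctionRight Grpd.{u, u} star

/-- Transposing along the adjunction turns the lifting problem into one for the underlying
isofibration. -/
theorem llp_freeZ2_intervalLeft : projectiveFibrations.llp (freeZ2.map intervalLeft.{u}) := by
  intro X Y p hp
  rw [freeZ2Adj.hasLiftingProperty_iff]
  exact (isofibrations_iff_hasLiftingProperty _).1 (hp star)

/-- Given `φ` out of `F.obj a`, choose `ψ : I.obj x ⟶ a`. The hypothesis lifts `F.map ψ ≫ φ` to a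
morphism out of `I.obj x`, and precomposing it with `inv ψ` lifts `φ`. -/
theorem isIsofibration_of_essSurj {X P Y : Type*} [Groupoid X] [Groupoid P] [Groupoid Y]
    {I : X ⥤ P} {F : P ⥤ Y} {f : X ⥤ Y} (hf : I ⋙ F = f)
    (hI : ∀ a, ∃ x, Nonempty (I.obj x ⟶ a))
    (hl : ∀ (a : Discrete PUnit.{u + 1} ⥤ X) (b : Interval.{u} ⥤ Y)
      (_ : a ⋙ f = Functor.fromPUnit Interval.left ⋙ b), ∃ c : Interval.{u} ⥤ P,
        Functor.fromPUnit Interval.left ⋙ c = a ⋙ I ∧ c ⋙ F = b) : IsIsofibration F := by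
  subst hf
  refine isIsofibration_of_exists_isHomLift fun a y φ => ?_
  obtain ⟨x, ⟨ψ⟩⟩ := hI a
  obtain ⟨c, h₁, h₂⟩ := hl (Functor.fromPUnit x) (Interval.functorOf (F.map ψ ≫ φ))
    ((fromPUnit_eq (Functor.fromPUnit x ⋙ I ⋙ F)).trans (fromPUnit_eq
      (Functor.fromPUnit Interval.left ⋙ Interval.functorOf (F.map ψ ≫ φ))).symm)
  have h₀ : c.obj Interval.left = I.obj x := Functor.congr_obj h₁ ⟨⟨⟩⟩
  have h₃ := comp_eq_iff_isHomLift.1 h₂ Interval.hom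
  rw [Interval.functorOf_map_hom] at h₃
  have h₄ : F.IsHomLift (F.map ψ ≫ φ) (c.map Interval.hom) := h₃
  exact ⟨c.obj Interval.right, inv ψ ≫ eqToHom h₀.symm ≫ c.map Interval.hom,
    isHomLift_inv_comp (β := F.map ψ) inferInstance inferInstance⟩

/-- The lifting problems of the interval against the underlying functor of a morphism. -/
structure PathSquare where
  top : Grpd.of (Discrete PUnit.{u + 1}) ⟶ X.obj star
  bot : Grpd.of Interval.{u} ⟶ Y.obj star
  w : top ≫ f.app star = intervalLeft ≫ bot

theorem exists_projective_factorization :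
    ∃ (P : GpdZ2.{u}) (i : X ⟶ P) (p : P ⟶ Y), i ≫ p = f ∧ projectiveFibrations.llp i ∧
      projectiveFibrations p := by
  let L : Grpd.{u, u} ⥤ GpdZ2.{u} := freeZ2
  let adj : L ⊣ (evaluation _ _).obj star := freeZ2Adj
  let t : (∐ fun _ : PathSquare f => L.obj (Grpd.of (Discrete PUnit.{u + 1}))) ⟶ X :=
    Sigma.desc fun s => (adj.homEquiv _ X).symm s.top
  let b : (∐ fun _ : PathSquare f => L.obj (Grpd.of Interval.{u})) ⟶ Y :=
    Sigma.desc fun s => (adj.homEquiv _ Y).symm s.bot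
  let σ : (∐ fun _ : PathSquare f => L.obj (Grpd.of (Discrete PUnit.{u + 1}))) ⟶
      ∐ fun _ : PathSquare f => L.obj (Grpd.of Interval.{u}) :=
    Limits.Sigma.map fun _ => L.map intervalLeft
  have w : t ≫ f = σ ≫ b := by
    refine Sigma.hom_ext _ _ fun s => ?_
    simp only [t, b, σ, Sigma.ι_desc_assoc, Sigma.ι_map_assoc, Sigma.ι_desc]
    rw [← adj.homEquiv_naturality_left_symm, ← adj.homEquiv_naturality_right_symm]
    exact congrArg _ s.w
  have hσ : projectiveFibrations.llp σ :=
    MorphismProperty.colimMap _ fun _ => llp_freeZ2_intervalLeft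
  let i : X ⟶ pushout t σ := pushout.inl t σ
  let p : pushout t σ ⟶ Y := pushout.desc f b w
  have hip : i ≫ p = f := pushout.inl_desc _ _ _
  have hi : projectiveFibrations.llp i :=
    MorphismProperty.of_isPushout (IsPushout.of_hasPushout t σ) hσ
  -- The solution is the transpose of the interval attached for `s` itself.
  have lift (s : PathSquare f) : ∃ c : Grpd.of Interval.{u} ⟶ (pushout t σ).obj star,
      intervalLeft ≫ c = s.top ≫ i.app star ∧ c ≫ p.app star = s.bot := by
    refine ⟨adj.homEquiv _ _ (Sigma.ι (fun _ => L.obj (Grpd.of Interval.{u})) s ≫ pushout.inr t σ),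
      ?_, ?_⟩
    · have h : L.map intervalLeft ≫ Sigma.ι (fun _ => L.obj (Grpd.of Interval.{u})) s ≫
          pushout.inr t σ = (adj.homEquiv _ X).symm s.top ≫ i := by
        have h₁ := congrArg (fun x => Sigma.ι _ s ≫ x) (pushout.condition (f := t) (g := σ))
        simpa only [t, σ, Sigma.ι_desc_assoc, Sigma.ι_map_assoc] using h₁.symm
      rw [← adj.homEquiv_naturality_left, h, adj.homEquiv_naturality_right, Equiv.apply_symm_apply]
      rfl
    · erw [← adj.homEquiv_naturality_right]
      rw [Category.assoc, pushout.inr_desc, Sigma.ι_desc, Equiv.apply_symm_apply]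
  refine ⟨_, i, p, hip, hi, (projectiveFibrations_iff p).2 ?_⟩
  exact isIsofibration_of_essSurj (I := i.app star) (congr_app hip star)
    (connectedToImage_of_llp i hi star) fun a b w => lift ⟨a, b, w⟩

end Factorization

/-! ### Assembly of the axioms -/

theorem isTypeTheoreticFibrationCategory_projectiveFibrations :
    IsTypeTheoreticFibrationCategory projectiveFibrations.{u} := by
  have hbc : projectiveFibrations.{u}.IsStableUnderBaseChange :=
    inferInstanceAs (isofibrations.{u}.functorCategory _).IsStableUnderBaseChange
  have hmul : projectiveFibrations.{u}.IsMultiplicative :=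
    { id_mem := fun X j => isofibrations.id_mem _
      comp_mem := fun f g hf hg j => isofibrations.comp_mem _ _ (hf j) (hg j) }
  have hpi {A B : GpdZ2.{u}} (g : A ⟶ B) (hg : projectiveFibrations g) (f : Over A) :
      ∃ D : PiDatum g f.hom, projectiveFibrations f.hom → projectiveFibrations D.proj := by
    obtain ⟨D, hD⟩ := PiDatum.exists_functor (g := g) (f := f.hom)
      fun j => grpdPiDatum (g.app j) (f.hom.app j) (hg j)
    exact ⟨D, fun hf => hD _ fun j => isIsofibration_piProj (hg j) (hf j)⟩
  refine
    { hasTerminal := inferInstance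
      isMultiplicative := hmul
      of_isIso := fun f _ => MorphismProperty.of_isIso _ f
      of_isTerminal := ?_
      hasPullbacksAlong := fun _ _ => inferInstance
      isStableUnderBaseChange := hbc
      pi_isDefined := ?_
      pi_fib := ?_
      hasFactorization := ?_ }
  · intro X T f hT j
    have hT' := IsTerminal.isTerminalObj ((evaluation _ Grpd.{u, u}).obj j) T hT
    rw [isofibrations_iff_hasLiftingProperty]
    -- The interval retracts onto its endpoint, so `r ≫ a` is a lift; the lower triangle commutes
    -- because evaluation preserves the terminal object.
    let r : Grpd.of Interval.{u} ⟶ Grpd.of (Discrete PUnit.{u + 1}) :=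
      (Functor.const Interval.{u}).obj (Discrete.mk PUnit.unit)
    have hr : intervalLeft ≫ r = 𝟙 _ := Functor.punit_ext' _ _
    refine ⟨fun {a b} sq => ⟨⟨r ≫ a, ?_, hT'.hom_ext _ _⟩⟩⟩
    rw [← Category.assoc, hr, Category.id_comp]
  · intro A B g hg f hf
    obtain ⟨D, -⟩ := hpi g hg f
    exact D.representableBy.isRepresentable
  · intro A B g hg f hf
    obtain ⟨D, hD⟩ := hpi g hg f.obj
    -- The value of `Π_g` and the constructed dependent product represent the same presheaf, and
    -- fibrations are invariant under isomorphism.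
    let e := D.representableBy.uniqueUpToIso
      ((Over.pullback g).op ⋙ yoneda.obj f.obj).representableBy
    exact (projectiveFibrations.arrow_mk_iso_iff (Arrow.isoMk ((Over.forget B).mapIso e) (Iso.refl _)
      ((Over.w e.hom).trans (Category.comp_id _).symm))).1 (hD hf)
  · exact ⟨fun f => by
      obtain ⟨P, i, p, h, hi, hp⟩ := exists_projective_factorization f
      exact ⟨⟨P, i, p, h, hi, hp⟩⟩⟩

end ProjectiveTTFC

theorem mainTheorem1 :
    ProjectiveTTFC.IsTypeTheoreticFibrationCategory ProjectiveTTFC.projectiveFibrations.{u} :=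
  ProjectiveTTFC.isTypeTheoreticFibrationCategory_projectiveFibrations
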